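/- Let $R$ be a commutative noetherian ring; all modules are finitely generated $R$-modules. The grade of a module $M$ is $\operatorname{grade}_R M=\inf\{i\ge 0\mid \operatorname{Ext}^i_R(M,R)\neq 0\}$. Put $(-)^*=\operatorname{Hom}_R(-,R)$. A module $G$ is totally reflexive if the natural map $G\to G^{**}$ is an isomorphism and $\operatorname{Ext}^i_R(G,R)=\operatorname{Ext}^i_R(G^*,R)=0$ for all $i>0$. The Gorenstein dimension $\operatorname{Gdim}_R M$ is the infimum of the integers $n\ge 0$ for which there is an exact sequence $0\to G_n\to\cdots\to G_0\to M\to 0$ with all $G_i$ totally reflexive. A module $M$ is G-perfect if $M\ne 0$ and $\operatorname{grade}_R M=\operatorname{Gdim}_R M$. A nonzero module $M$ of grade $g$ is totally self-dual if $\operatorname{Ext}^g_R(M,R)\cong M$ and $\operatorname{Ext}^i_R(M,R)=0$ for all $i\ne g$. Proposition. Let $M$ be a nonzero $R$-module of grade $g$. Then $M$ is totally self-dual if and only if $M$ is G-perfect and $\operatorname{Ext}^g_R(M,R)\cong M$. Thus, for every integer $g\ge 0$, the totally self-dual $R$-modules of grade $g$ are exactly the fixed points, up to isomorphism, of $\operatorname{Ext}^g_R(-,R)$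 in the class $\mathcal M_g(R)$ of G-perfect $R$-modules of grade $g$, that is, the modules $M\in\mathcal M_g(R)$ with $\operatorname{Ext}^g_R(M,R)\cong M$. -/

import Mathlib

open CategoryTheory

universe u

section TotallySelfDual

variable (R : Type u) [CommRing R]

/-- The `R`-module `Ext^i_R(M, R)`. -/
noncomputable abbrev ExtDual (M : Type u) [AddCommGroup M] [Module R M] (i : ℕ) : Type u :=
  Abelian.Ext (ModuleCat.of R M) (ModuleCat.of R R) i

/-- The grade of `M`: the infimum of all `i` such that `Ext^i_R(M, R) ≠ 0`
(it is `⊤` if there is no such `i`). -/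
noncomputable def moduleGrade (M : Type u) [AddCommGroup M] [Module R M] : ℕ∞ :=
  ⨅ (i : ℕ) (_ : Nontrivial (ExtDual R M i)), (i : ℕ∞)

/-- `M` is totally self-dual: it is nonzero, and with `g` its grade, `Ext^g_R(M, R) ≅ M` as
`R`-modules and `Ext^i_R(M, R) = 0` for all `i ≠ g`. -/
def IsTotallySelfDual (M : Type u) [AddCommGroup M] [Module R M] : Prop :=
  Nontrivial M ∧ ∃ g : ℕ, moduleGrade R M = g ∧
    Nonempty (ExtDual R M g ≃ₗ[R] M) ∧ ∀ i : ℕ, i ≠ g → Subsingleton (ExtDual R M i)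

/-- A finitely generated module `M` is totally reflexive if the natural map `M → M**` is bijective
and `Ext^i_R(M, R) = Ext^i_R(M*, R) = 0` for all `i > 0`. -/
structure IsTotallyReflexive (M : Type u) [AddCommGroup M] [Module R M] : Prop where
  finite : Module.Finite R M
  bijective_eval : Function.Bijective (Module.Dual.eval R M)
  ext_eq_zero : ∀ i : ℕ, 0 < i → Subsingleton (ExtDual R M i)
  ext_dual_eq_zero : ∀ i : ℕ, 0 < i → Subsingleton (ExtDual R (Module.Dual R M) i)

/-- There is an exact sequence `0 → G n → ⋯ → G 0 → M → 0` with all `G i` totally reflexive;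
the sequence is continued by zero modules in degrees `i > n`. -/
def HasTotallyReflexiveResolution (M : Type u) [AddCommGroup M] [Module R M] (n : ℕ) : Prop :=
  ∃ (G : ℕ → ModuleCat.{u} R) (d : ∀ i, G (i + 1) →ₗ[R] G i) (ε : G 0 →ₗ[R] M),
    Function.Surjective ε ∧ Function.Exact (d 0) ε ∧
    (∀ i, Function.Exact (d (i + 1)) (d i)) ∧
    (∀ i ≤ n, IsTotallyReflexive R (G i)) ∧
    ∀ i, n < i → Subsingleton (G i)

/-- The Gorenstein dimension of `M`: the infimum of the lengths of resolutions of `M` by totally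
reflexive modules (it is `⊤` if there is no such resolution). -/
noncomputable def gorensteinDim (M : Type u) [AddCommGroup M] [Module R M] : ℕ∞ :=
  ⨅ (n : ℕ) (_ : HasTotallyReflexiveResolution R M n), (n : ℕ∞)

/-- `M` is G-perfect: it is nonzero and its grade equals its Gorenstein dimension. -/
def IsGPerfect (M : Type u) [AddCommGroup M] [Module R M] : Prop :=
  Nontrivial M ∧ moduleGrade R M = gorensteinDim R M

/-- The class of finitely generated G-perfect `R`-modules of grade `g`. -/
def gPerfectModules (g : ℕ) : Set (ModuleCat.{u} R) :=
  {M | Module.Finite R M ∧ IsGPerfect R M ∧ moduleGrade R M = g}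

end TotallySelfDual

/-! Vanishing of `Ext` below the grade is automatic, and a totally reflexive resolution of length at
most `g` forces vanishing above `g` by dimension shifting; this settles one implication. The
substance of the other is a totally reflexive resolution of length `g`; since `Ext^g(M, R) ≠ 0`,
none is shorter.

For `g = 0`, an isomorphism `φ : M ≅ M*` has a transpose `φ'`, and dualizing `φ'` gives a map `M** →
M*` whose composite with the biduality map is `φ`. That map is surjective between two copies of a
noetherian module, hence injective, so biduality is bijective.

For `g = n + 1`, take finite projectives `P j` resolving `M = Z 0`, with syzygies `Z j`; the claim
is that `Z (n+1)` is totally reflexive. As `Ext^a(M, R) = 0` for `a ≤ n`, dualizing gives an exact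
sequence `0 → P 0* → ⋯ → P n* → Z (n+1)* → N → 0` with `N ≅ Ext^{n+1}(M, R) ≅ M`. Composing its
Yoneda class `totalClass` with evaluations defines a map `P 0 → Ext^{n+1}(N, R)`. Dualizing once
more recovers the `P j`, and total reflexivity comes down to this map being onto with kernel inside
`Z 1`. That is `exists_totalClass_comp_evalP`, proved as for `g = 0`: transposing a lift of `φ : M ≅
N` yields `ψ : M → N`, and `Ext^{n+1}(ψ, R)` composed with the map is `φ ∘ p 0`, up to the
identification of `N` with `Ext^{n+1}(M, R)`. So `Ext^{n+1}(ψ, R)` is a surjection between copies of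
`M`, hence bijective. -/

/-! ### Long exact `Ext` sequences and the case of grade zero -/

section ExtLemmas

open Abelian

variable {R : Type u} [CommRing R]

/-- The sequence of linear maps `0 → A → B → C → 0` is exact. -/
structure IsShortExactSeq {A B C : ModuleCat.{u} R} (f : A →ₗ[R] B) (g : B →ₗ[R] C) : Prop where
  injective : Function.Injective f
  exact : Function.Exact f g
  surjective : Function.Surjective g

namespace IsShortExactSeq

variable {A B C : ModuleCat.{u} R} {f : A →ₗ[R] B} {g : B →ₗ[R] C} (h : IsShortExactSeq f g)

include h

lemma comp_eq_zero : ModuleCat.ofHom f ≫ ModuleCat.ofHom g = 0 :=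
  ModuleCat.hom_ext h.exact.linearMap_comp_eq_zero

lemma shortExact :
    (ShortComplex.mk (ModuleCat.ofHom f) (ModuleCat.ofHom g) h.comp_eq_zero).ShortExact where
  exact := (ShortComplex.ShortExact.moduleCat_exact_iff_function_exact _).2 h.exact
  mono_f := (ModuleCat.mono_iff_injective _).2 h.injective
  epi_g := (ModuleCat.epi_iff_surjective _).2 h.surjective

/-- The class in `Ext^1(C, A)` of a short exact sequence `0 → A → B → C → 0`. -/
noncomputable def extClass : Ext C A 1 := h.shortExact.extClass

variable {Y : ModuleCat.{u} R}

lemma extClass_comp_mk₀_comp {n m : ℕ} (x : Ext B Y n) (hm : 1 + n = m) :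
    h.extClass.comp ((Ext.mk₀ (ModuleCat.ofHom f)).comp x (zero_add n)) hm = 0 :=
  h.shortExact.extClass_comp_assoc x

lemma extClass_comp_mk₀_eq_zero (F : A ⟶ Y) (G : B →ₗ[R] Y) (hFG : ∀ a, F.hom a = G (f a)) :
    h.extClass.comp (Ext.mk₀ F) (add_zero 1) = 0 := by
  have : F = ModuleCat.ofHom f ≫ ModuleCat.ofHom G := ModuleCat.hom_ext (LinearMap.ext hFG)
  rw [this, ← Ext.mk₀_comp_mk₀]
  exact h.extClass_comp_mk₀_comp _ _

lemma mk₀_comp_extClass_comp {n m : ℕ} (x : Ext A Y n) (hm : 1 + n = m) :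
    (Ext.mk₀ (ModuleCat.ofHom g)).comp (h.extClass.comp x hm) (zero_add m) = 0 :=
  h.shortExact.comp_extClass_assoc x hm

lemma exists_mk₀_f_comp_eq {n m : ℕ} (x : Ext A Y n) (hm : 1 + n = m)
    (hx : h.extClass.comp x hm = 0) :
    ∃ y : Ext B Y n, (Ext.mk₀ (ModuleCat.ofHom f)).comp y (zero_add n) = x :=
  Ext.contravariant_sequence_exact₁ h.shortExact Y x hm hx

lemma exists_mk₀_g_comp_eq {n : ℕ} (x : Ext B Y n)
    (hx : (Ext.mk₀ (ModuleCat.ofHom f)).comp x (zero_add n) = 0) :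
    ∃ y : Ext C Y n, (Ext.mk₀ (ModuleCat.ofHom g)).comp y (zero_add n) = x :=
  Ext.contravariant_sequence_exact₂ h.shortExact Y x hx

lemma exists_extClass_comp_eq {n m : ℕ} (x : Ext C Y m) (hm : 1 + n = m)
    (hx : (Ext.mk₀ (ModuleCat.ofHom g)).comp x (zero_add m) = 0) :
    ∃ y : Ext A Y n, h.extClass.comp y hm = x :=
  Ext.contravariant_sequence_exact₃ h.shortExact Y x hx hm

lemma exists_comp_extClass_eq {n m : ℕ} (x : Ext Y A m) (hm : n + 1 = m)
    (hx : x.comp (Ext.mk₀ (ModuleCat.ofHom f)) (add_zero m) = 0) :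
    ∃ y : Ext Y C n, y.comp h.extClass hm = x :=
  Ext.covariant_sequence_exact₁ Y h.shortExact x hx hm

lemma subsingleton_middle {n : ℕ} (hA : Subsingleton (Ext A Y n))
    (hC : Subsingleton (Ext C Y n)) : Subsingleton (Ext B Y n) :=
  subsingleton_of_forall_eq 0 fun x => by
    obtain ⟨y, rfl⟩ := h.exists_mk₀_g_comp_eq x (Subsingleton.elim _ _)
    rw [Subsingleton.elim y 0, Ext.comp_zero]

lemma subsingleton_right {n m : ℕ} (hm : 1 + n = m) (hA : Subsingleton (Ext A Y n))
    (hB : Subsingleton (Ext B Y m)) : Subsingleton (Ext C Y m) :=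
  subsingleton_of_forall_eq 0 fun x => by
    obtain ⟨y, rfl⟩ := h.exists_extClass_comp_eq x hm (Subsingleton.elim _ _)
    rw [Subsingleton.elim y 0, Ext.comp_zero]

end IsShortExactSeq

lemma subsingleton_ext_of_projective {P Y : ModuleCat.{u} R} [Module.Projective R P] {n : ℕ}
    (hn : 0 < n) : Subsingleton (Ext P Y n) := by
  obtain ⟨n, rfl⟩ : ∃ j, n = j + 1 := ⟨n - 1, by omega⟩
  exact Ext.subsingleton_of_projective _ _ _

lemma mk₀_comp_comp_mk₀_eq {A B C D Y : ModuleCat.{u} R} {n : ℕ} {ψ : A ⟶ B} {τ : Ext B C n}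
    {σ : Ext A D n} {t : D ⟶ C}
    (h : (Ext.mk₀ ψ).comp τ (zero_add n) = σ.comp (Ext.mk₀ t) (add_zero n)) (f : C ⟶ Y) :
    (Ext.mk₀ ψ).comp (τ.comp (Ext.mk₀ f) (add_zero n)) (zero_add n) =
      σ.comp (Ext.mk₀ (t ≫ f)) (add_zero n) := by
  rw [← Ext.mk₀_comp_mk₀, ← Ext.comp_assoc_of_third_deg_zero,
    ← Ext.comp_assoc_of_third_deg_zero, h]

/-- The isomorphism `Ext^i(B, Y) ≃ Ext^i(A, Y)` induced by an isomorphism `A ≅ B`. -/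
noncomputable def extPrecompEquiv {A B : ModuleCat.{u} R} (e : A ≅ B) (Y : ModuleCat.{u} R)
    (i : ℕ) : Ext B Y i ≃ₗ[R] Ext A Y i where
  toFun x := (Ext.mk₀ e.hom).comp x (zero_add i)
  invFun x := (Ext.mk₀ e.inv).comp x (zero_add i)
  map_add' := by simp
  map_smul' := by simp
  left_inv x := by simp
  right_inv x := by simp

/-- The isomorphism `Ext^i(N, R) ≃ Ext^i(M, R)` induced by an isomorphism `M ≃ N`. -/
noncomputable def extDualCongr {M N : Type u} [AddCommGroup M] [AddCommGroup N] [Module R M]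
    [Module R N] (e : M ≃ₗ[R] N) (i : ℕ) : ExtDual R N i ≃ₗ[R] ExtDual R M i :=
  extPrecompEquiv e.toModuleIso _ i

/-- `Ext^0(M, R)` is the dual of `M`. -/
noncomputable def extDualZeroEquiv (M : Type u) [AddCommGroup M] [Module R M] :
    ExtDual R M 0 ≃ₗ[R] Module.Dual R M :=
  Ext.linearEquiv₀.trans ModuleCat.homLinearEquiv

lemma subsingleton_ext_of_retract {X Y F : ModuleCat.{u} R} (s : F ⟶ Y) (r : Y ⟶ F)
    (h : s ≫ r = 𝟙 F) {i : ℕ} (hY : Subsingleton (Ext X Y i)) : Subsingleton (Ext X F i) := by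
  refine ⟨fun a b => ?_⟩
  have key : ∀ c : Ext X F i, c = 0 := fun c => by
    rw [← Ext.comp_mk₀_id c, ← h, ← Ext.mk₀_comp_mk₀, ← Ext.comp_assoc_of_second_deg_zero,
      Subsingleton.elim (c.comp (Ext.mk₀ s) (add_zero i)) 0, Ext.zero_comp]
  rw [key a, key b]

lemma subsingleton_ext_pi {X : ModuleCat.{u} R} {i : ℕ}
    (hX : Subsingleton (Ext X (ModuleCat.of R R) i)) (k : ℕ) :
    Subsingleton (Ext X (ModuleCat.of R (Fin k → R)) i) := by
  have id_eq : 𝟙 (ModuleCat.of R (Fin k → R)) =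
      ∑ j : Fin k, ModuleCat.ofHom (LinearMap.proj (R := R) (φ := fun _ : Fin k => R) j) ≫
        ModuleCat.ofHom (LinearMap.single R (fun _ : Fin k => R) j) := by
    ext1
    simp only [ModuleCat.hom_id, ModuleCat.hom_sum, ModuleCat.hom_comp, ModuleCat.hom_ofHom]
    ext x
    simp [Finset.sum_apply, Pi.single_apply]
  have key : ∀ c : Ext X (ModuleCat.of R (Fin k → R)) i, c = 0 := fun c => by
    rw [← Ext.comp_mk₀_id c, id_eq, Ext.mk₀_sum, Ext.comp_sum]
    refine Finset.sum_eq_zero fun j _ => ?_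
    rw [← Ext.mk₀_comp_mk₀, ← Ext.comp_assoc_of_second_deg_zero,
      Subsingleton.elim (c.comp (Ext.mk₀ _) (add_zero i)) 0, Ext.zero_comp]
  exact ⟨fun a b => by rw [key a, key b]⟩

lemma subsingleton_ext_of_finite_projective {X F : ModuleCat.{u} R} [Module.Finite R F]
    [Module.Projective R F] {i : ℕ} (hX : Subsingleton (Ext X (ModuleCat.of R R) i)) :
    Subsingleton (Ext X F i) := by
  obtain ⟨k, f, hf⟩ := Module.Finite.exists_fin' R F
  obtain ⟨s, hs⟩ := Module.projective_lifting_property f LinearMap.id hf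
  exact subsingleton_ext_of_retract (ModuleCat.ofHom s) (ModuleCat.ofHom f)
    (by ext1; simpa using hs) (subsingleton_ext_pi hX k)

/-- Transported to `M`, the map is a surjective endomorphism of a noetherian module. This is the
only finiteness argument behind biduality, both in grade zero and in positive grade. -/
lemma injective_of_surjective_of_equiv [IsNoetherianRing R] {M A B : Type u} [AddCommGroup M]
    [AddCommGroup A] [AddCommGroup B] [Module R M] [Module R A] [Module R B] [Module.Finite R M]
    (e : A ≃ₗ[R] M) (e' : B ≃ₗ[R] M) (f : A →ₗ[R] B) (hf : Function.Surjective f) :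
    Function.Injective f := by
  have : Function.Injective (e'.toLinearMap ∘ₗ f ∘ₗ e.symm.toLinearMap) :=
    IsNoetherian.injective_of_surjective_endomorphism _ (by simpa using hf)
  intro a b hab
  have := @this (e a) (e b) (by simp [hab])
  simpa using this

lemma bijective_dual_eval_of_equiv_dual [IsNoetherianRing R] (M : Type u) [AddCommGroup M]
    [Module R M] [Module.Finite R M] (φ : M ≃ₗ[R] Module.Dual R M) :
    Function.Bijective (Module.Dual.eval R M) := by
  -- The form `φ a b` need not be symmetric, so the transpose is a genuinely different map.
  let φ' : M →ₗ[R] Module.Dual R M := φ.toLinearMap.flip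
  have h : φ'.dualMap ∘ₗ Module.Dual.eval R M = φ.toLinearMap := by
    ext a b; simp [φ']
  have hsurj : Function.Surjective φ'.dualMap := fun y => by
    obtain ⟨x, rfl⟩ := φ.surjective y
    exact ⟨_, LinearMap.congr_fun h x⟩
  have hinj : Function.Injective φ'.dualMap :=
    injective_of_surjective_of_equiv (φ.dualMap.trans φ.symm) φ.symm _ hsurj
  refine ⟨fun a b hab => φ.injective ?_, fun y => ?_⟩
  · rw [← LinearEquiv.coe_coe, ← h]; simp [hab]
  · obtain ⟨x, hx⟩ := φ.surjective (φ'.dualMap y)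
    exact ⟨x, hinj ((LinearMap.congr_fun h x).trans hx)⟩

end ExtLemmas

/-! ### Grade, Gorenstein dimension and dimension shifting -/

section GorensteinDimension

open Abelian

variable {R : Type u} [CommRing R]

lemma subsingleton_extDual_of_lt_moduleGrade {M : Type u} [AddCommGroup M] [Module R M] {g : ℕ}
    (h : moduleGrade R M = g) {i : ℕ} (hi : i < g) : Subsingleton (ExtDual R M i) := by
  by_contra hne
  rw [not_subsingleton_iff_nontrivial] at hne
  have : moduleGrade R M ≤ i := iInf₂_le i hne
  rw [h] at this
  exact absurd (Nat.cast_le.1 this) (not_le.2 hi)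

lemma nontrivial_extDual_of_moduleGrade_eq {M : Type u} [AddCommGroup M] [Module R M] {g : ℕ}
    (h : moduleGrade R M = g) : Nontrivial (ExtDual R M g) := by
  by_contra hne
  have : ((g + 1 : ℕ) : ℕ∞) ≤ moduleGrade R M := by
    refine le_iInf₂ fun i hi => Nat.cast_le.2 ?_
    by_contra hlt
    obtain hlt | rfl := (Nat.lt_succ_iff.1 (not_le.1 hlt)).lt_or_eq
    · exact not_subsingleton_iff_nontrivial.2 hi (subsingleton_extDual_of_lt_moduleGrade h hlt)
    · exact hne hi
  rw [h, Nat.cast_le] at this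
  omega

lemma HasTotallyReflexiveResolution.of_isTotallyReflexive (M : Type u) [AddCommGroup M]
    [Module R M] (h : IsTotallyReflexive R M) : HasTotallyReflexiveResolution R M 0 := by
  refine ⟨fun i => Nat.casesOn i (ModuleCat.of R M) fun _ => ModuleCat.of R PUnit, fun i => 0,
    LinearMap.id, Function.surjective_id, ?_, ?_, ?_, ?_⟩
  · intro x
    simp [eq_comm]
  · intro i x
    refine ⟨fun _ => ⟨0, Subsingleton.elim (α := PUnit) _ _⟩, fun _ => rfl⟩
  · rintro i hi
    obtain rfl := Nat.le_zero.1 hi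
    exact h
  · rintro (_ | i) hi
    · omega
    · exact inferInstanceAs (Subsingleton PUnit)

lemma HasTotallyReflexiveResolution.succ {X G M : Type u} [AddCommGroup X] [AddCommGroup G]
    [AddCommGroup M] [Module R X] [Module R G] [Module R M] (f : X →ₗ[R] G) (p : G →ₗ[R] M)
    (hf : Function.Injective f) (hfp : Function.Exact f p) (hp : Function.Surjective p)
    (hG : IsTotallyReflexive R G) {n : ℕ} (hX : HasTotallyReflexiveResolution R X n) :
    HasTotallyReflexiveResolution R M (n + 1) := by
  obtain ⟨H, d, ε, hε, hdε, hd, hH, hH0⟩ := hX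
  refine ⟨fun i => Nat.casesOn i (ModuleCat.of R G) H,
    fun i => Nat.casesOn i (f ∘ₗ ε) d, p, hp, ?_, ?_, ?_, ?_⟩
  · intro x
    refine (hfp x).trans ⟨?_, ?_⟩
    · rintro ⟨y, rfl⟩
      obtain ⟨z, rfl⟩ := hε y
      exact ⟨z, rfl⟩
    · rintro ⟨z, rfl⟩
      exact ⟨ε z, rfl⟩
  · rintro (_ | i)
    · intro x
      exact (map_eq_zero_iff f hf).trans (hdε x)
    · exact hd i
  · rintro (_ | i) hi
    · exact hG
    · exact hH i (by omega)
  · rintro (_ | i) hi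
    · omega
    · exact hH0 i (by omega)

lemma HasTotallyReflexiveResolution.exists_equiv {M : Type u} [AddCommGroup M] [Module R M]
    (h : HasTotallyReflexiveResolution R M 0) :
    ∃ G : ModuleCat.{u} R, IsTotallyReflexive R G ∧ Nonempty (G ≃ₗ[R] M) := by
  obtain ⟨G, d, ε, hε, hdε, -, hG, hG0⟩ := h
  refine ⟨G 0, hG 0 le_rfl, ⟨LinearEquiv.ofBijective ε ⟨?_, hε⟩⟩⟩
  rw [injective_iff_map_eq_zero]
  intro x hx
  obtain ⟨y, rfl⟩ := (hdε x).1 hx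
  have := hG0 1 one_pos
  rw [Subsingleton.elim y 0, map_zero]

lemma HasTotallyReflexiveResolution.exists_exact {M : Type u} [AddCommGroup M] [Module R M]
    {n : ℕ} (h : HasTotallyReflexiveResolution R M (n + 1)) :
    ∃ (G : ModuleCat.{u} R) (p : G →ₗ[R] M), Function.Surjective p ∧ IsTotallyReflexive R G ∧
      HasTotallyReflexiveResolution R (LinearMap.ker p) n := by
  obtain ⟨G, d, ε, hε, hdε, hd, hG, hG0⟩ := h
  refine ⟨G 0, ε, hε, hG 0 (Nat.zero_le _), fun i => G (i + 1), fun i => d (i + 1),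
    (d 0).codRestrict _ fun x => hdε.apply_apply_eq_zero x, ?_, ?_, fun i => hd (i + 1),
    fun i hi => hG (i + 1) (by omega), fun i hi => hG0 (i + 1) (by omega)⟩
  · rintro ⟨x, hx⟩
    obtain ⟨y, rfl⟩ := (hdε x).1 hx
    exact ⟨y, rfl⟩
  · intro x
    rw [← hd 0 x, ← Subtype.coe_inj]
    rfl

lemma HasTotallyReflexiveResolution.subsingleton_extDual {n : ℕ} :
    ∀ {M : Type u} [AddCommGroup M] [Module R M], HasTotallyReflexiveResolution R M n →
      ∀ {i : ℕ}, n < i → Subsingleton (ExtDual R M i) := by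
  induction n with
  | zero =>
    intro M _ _ h i hi
    obtain ⟨G, hG, ⟨e⟩⟩ := h.exists_equiv
    have := hG.ext_eq_zero i hi
    exact (extDualCongr e.symm i).toEquiv.symm.subsingleton
  | succ n ih =>
    intro M _ _ h i hi
    obtain ⟨G, p, hp, hG, hX⟩ := h.exists_exact
    have hS : IsShortExactSeq (A := ModuleCat.of R (LinearMap.ker p)) (C := ModuleCat.of R M)
        (LinearMap.ker p).subtype p :=
      ⟨Subtype.val_injective, LinearMap.exact_subtype_ker_map p, hp⟩
    obtain ⟨i, rfl⟩ : ∃ j, i = 1 + j := ⟨i - 1, by omega⟩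
    exact hS.subsingleton_right rfl (ih hX (by omega)) (hG.ext_eq_zero (1 + i) (by omega))

/-- A resolution of length less than `g` would kill `Ext^g(M, R)`. -/
lemma gorensteinDim_eq_of_hasTotallyReflexiveResolution {M : Type u} [AddCommGroup M]
    [Module R M] {g : ℕ} (h : HasTotallyReflexiveResolution R M g)
    (hg : Nontrivial (ExtDual R M g)) : gorensteinDim R M = g := by
  refine le_antisymm (iInf₂_le g h) (le_iInf₂ fun n hn => Nat.cast_le.2 ?_)
  by_contra hlt
  exact not_subsingleton_iff_nontrivial.2 hg (hn.subsingleton_extDual (not_le.1 hlt))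

lemma hasTotallyReflexiveResolution_of_gorensteinDim_eq {M : Type u} [AddCommGroup M]
    [Module R M] {g : ℕ} (h : gorensteinDim R M = g) :
    ∃ n ≤ g, HasTotallyReflexiveResolution R M n := by
  by_contra hne
  push Not at hne
  have : ((g + 1 : ℕ) : ℕ∞) ≤ gorensteinDim R M := by
    refine le_iInf₂ fun i hi => Nat.cast_le.2 ?_
    by_contra hlt
    exact hne i (by omega) hi
  rw [h, Nat.cast_le] at this
  omega

lemma isTotallyReflexive_of_finite_projective (M : Type u) [AddCommGroup M]
    [Module R M] [Module.Finite R M] [Module.Projective R M] : IsTotallyReflexive R M where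
  finite := inferInstance
  bijective_eval := Module.bijective_dual_eval R M
  ext_eq_zero _ hi := subsingleton_ext_of_projective (P := ModuleCat.of R M) hi
  ext_dual_eq_zero _ hi :=
    subsingleton_ext_of_projective (P := ModuleCat.of R (Module.Dual R M)) hi

lemma IsTotallySelfDual.of_isGPerfect {M : Type u} [AddCommGroup M] [Module R M] {g : ℕ}
    (hg : moduleGrade R M = g) (h : IsGPerfect R M) (e : Nonempty (ExtDual R M g ≃ₗ[R] M)) :
    IsTotallySelfDual R M := by
  refine ⟨h.1, g, hg, e, fun i hi => ?_⟩
  obtain hi | hi := hi.lt_or_gt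
  · exact subsingleton_extDual_of_lt_moduleGrade hg hi
  · obtain ⟨n, hn, hM⟩ := hasTotallyReflexiveResolution_of_gorensteinDim_eq (h.2.symm.trans hg)
    exact hM.subsingleton_extDual (by omega)

lemma isTotallyReflexive_of_equiv_dual [IsNoetherianRing R] (M : Type u) [AddCommGroup M]
    [Module R M] [Module.Finite R M] (e : ExtDual R M 0 ≃ₗ[R] M)
    (h : ∀ i : ℕ, 0 < i → Subsingleton (ExtDual R M i)) : IsTotallyReflexive R M where
  finite := inferInstance
  bijective_eval := bijective_dual_eval_of_equiv_dual M (e.symm.trans (extDualZeroEquiv M))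
  ext_eq_zero := h
  ext_dual_eq_zero i hi := have := h i hi
    (extDualCongr (e.symm.trans (extDualZeroEquiv M)).symm i).toEquiv.symm.subsingleton

end GorensteinDimension

/-! ### Projective resolutions and `Ext` as a cokernel -/

section Syzygies

open Abelian

variable (R : Type u) [CommRing R]

/-- A resolution of the module `Z 0` by finite projective modules `P j`, split into short exact
sequences `0 → Z (j + 1) → P j → Z j → 0`. -/
structure SyzygySequence where
  /-- The syzygies. -/
  Z : ℕ → ModuleCat.{u} R
  /-- The projective modules. -/
  P : ℕ → ModuleCat.{u} R
  /-- The inclusion of a syzygy. -/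
  i : ∀ j, Z (j + 1) →ₗ[R] P j
  /-- The projection onto a syzygy. -/
  p : ∀ j, P j →ₗ[R] Z j
  injective : ∀ j, Function.Injective (i j)
  exact : ∀ j, Function.Exact (i j) (p j)
  surjective : ∀ j, Function.Surjective (p j)
  finite_Z : ∀ j, Module.Finite R (Z j)
  finite_P : ∀ j, Module.Finite R (P j)
  projective_P : ∀ j, Module.Projective R (P j)

variable {R}

lemma SyzygySequence.exists_Z_zero_eq [IsNoetherianRing R] (M : ModuleCat.{u} R)
    [hM : Module.Finite R M] : ∃ S : SyzygySequence R, S.Z 0 = M := by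
  choose r f hf using fun X : {X : ModuleCat.{u} R // Module.Finite R X} =>
    haveI := X.2; Module.Finite.exists_fin' R X.1
  let Z : ℕ → {X : ModuleCat.{u} R // Module.Finite R X} := fun n =>
    Nat.rec ⟨M, hM⟩ (fun _ X => ⟨ModuleCat.of R (LinearMap.ker (f X)), inferInstance⟩) n
  exact ⟨{
    Z := fun j => (Z j).1
    P := fun j => ModuleCat.of R (Fin (r (Z j)) → R)
    i := fun j => (LinearMap.ker (f (Z j))).subtype
    p := fun j => f (Z j)
    injective := fun j => Subtype.val_injective
    exact := fun j => LinearMap.exact_subtype_ker_map _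
    surjective := fun j => hf (Z j)
    finite_Z := fun j => (Z j).2
    finite_P := fun j => inferInstanceAs (Module.Finite R (Fin (r (Z j)) → R))
    projective_P := fun j => inferInstanceAs (Module.Projective R (Fin (r (Z j)) → R)) }, rfl⟩

namespace SyzygySequence

variable (S : SyzygySequence R)

instance (j : ℕ) : Module.Finite R (S.Z j) := S.finite_Z j
instance (j : ℕ) : Module.Finite R (S.P j) := S.finite_P j
instance (j : ℕ) : Module.Projective R (S.P j) := S.projective_P j

lemma p_i (j : ℕ) (x : S.Z (j + 1)) : S.p j (S.i j x) = 0 := (S.exact j).apply_apply_eq_zero x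

lemma shortExact (j : ℕ) : IsShortExactSeq (S.i j) (S.p j) :=
  ⟨S.injective j, S.exact j, S.surjective j⟩

/-- The class in `Ext^j(Z 0, Z j)` of the first `j` steps of the resolution. -/
noncomputable def extClass : ∀ j, Ext (S.Z 0) (S.Z j) j
  | 0 => Ext.mk₀ (𝟙 _)
  | j + 1 => (extClass j).comp (S.shortExact j).extClass rfl

lemma extClass_succ_comp (j : ℕ) {Y : ModuleCat.{u} R} {a b m : ℕ} (x : Ext (S.Z (j + 1)) Y a)
    (h : j + 1 + a = m) (hb : 1 + a = b) : (S.extClass (j + 1)).comp x h =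
      (S.extClass j).comp ((S.shortExact j).extClass.comp x hb) (by omega) := by
  exact Ext.comp_assoc _ _ _ _ _ (by omega)

/-- Dimension shifting in Yoneda form. Positive degree `a + 1` is needed: in degree zero, maps
extending to the projective are killed. -/
lemma bijective_extClass_comp (Y : ModuleCat.{u} R) (j : ℕ) : ∀ {a m : ℕ} (h : j + (a + 1) = m),
    Function.Bijective (fun x : Ext (S.Z j) Y (a + 1) => (S.extClass j).comp x h) := by
  induction j with
  | zero =>
    intro a m h
    obtain rfl : a + 1 = m := by omega
    convert Function.bijective_id using 2 with x
    simp [extClass]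
  | succ j ih =>
    intro a m h
    have hab : 1 + (a + 1) = (a + 1) + 1 := by omega
    have h1 : Function.Bijective
        (fun x : Ext (S.Z (j + 1)) Y (a + 1) => (S.shortExact j).extClass.comp x hab) := by
      have hP : ∀ b, Subsingleton (Ext (S.P j) Y (b + 1)) := fun b =>
        subsingleton_ext_of_projective b.succ_pos
      refine ⟨(injective_iff_map_eq_zero ((S.shortExact j).extClass.precomp Y hab)).2
        fun x hx => ?_, fun x => ?_⟩
      · obtain ⟨y, rfl⟩ := (S.shortExact j).exists_mk₀_f_comp_eq x hab hx
        rw [Subsingleton.elim y 0, Ext.comp_zero]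
      · exact (S.shortExact j).exists_extClass_comp_eq x hab (Subsingleton.elim _ _)
    have h2 := (ih (show j + ((a + 1) + 1) = m by omega)).comp h1
    refine (congrArg Function.Bijective (funext fun x => ?_)).mpr h2
    exact S.extClass_succ_comp j x h _

lemma surjective_extClass_comp_mk₀ (Y : ModuleCat.{u} R) (j : ℕ) (x : Ext (S.Z 0) Y (j + 1)) :
    ∃ f : S.Z (j + 1) ⟶ Y, (S.extClass (j + 1)).comp (Ext.mk₀ f) (add_zero _) = x := by
  obtain ⟨y, rfl⟩ := (S.bijective_extClass_comp Y j (a := 0) rfl).2 x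
  have : Subsingleton (Ext (S.P j) Y 1) := subsingleton_ext_of_projective one_pos
  obtain ⟨z, rfl⟩ := (S.shortExact j).exists_extClass_comp_eq y (add_zero 1)
    (Subsingleton.elim _ _)
  obtain ⟨f, rfl⟩ := (Ext.mk₀_bijective _ _).2 z
  exact ⟨f, S.extClass_succ_comp j _ _ _⟩

lemma extClass_comp_mk₀_eq_zero_iff {Y : ModuleCat.{u} R} (j : ℕ) (f : S.Z (j + 1) ⟶ Y) :
    (S.extClass (j + 1)).comp (Ext.mk₀ f) (add_zero _) = 0 ↔
      ∃ g : S.P j ⟶ Y, ModuleCat.ofHom (S.i j) ≫ g = f := by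
  have h0 : ∀ y : Ext (S.Z j) Y 1, (S.extClass j).comp y rfl = 0 ↔ y = 0 := fun y =>
    map_eq_zero_iff ((S.extClass j).precomp Y rfl) (S.bijective_extClass_comp Y j (a := 0) rfl).1
  rw [S.extClass_succ_comp j _ _ (add_zero 1)]
  refine (h0 _).trans ⟨fun h => ?_, ?_⟩
  · obtain ⟨y, hy⟩ := (S.shortExact j).exists_mk₀_f_comp_eq _ _ h
    obtain ⟨g, rfl⟩ := (Ext.mk₀_bijective _ _).2 y
    exact ⟨g, (Ext.mk₀_bijective _ _).1 ((Ext.mk₀_comp_mk₀ _ _).symm.trans hy)⟩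
  · rintro ⟨g, rfl⟩
    rw [← Ext.mk₀_comp_mk₀]
    exact (S.shortExact j).extClass_comp_mk₀_comp (Ext.mk₀ g) _

lemma subsingleton_extDual_Z {j a : ℕ} (h : Subsingleton (ExtDual R (S.Z 0) (j + (a + 1)))) :
    Subsingleton (ExtDual R (S.Z j) (a + 1)) :=
  (S.bijective_extClass_comp (ModuleCat.of R R) j (a := a) rfl).1.subsingleton

/-- The functionals on the syzygy `Z (j + 1)` that extend to `P j`. -/
def extendable (j : ℕ) : Submodule R (Module.Dual R (S.Z (j + 1))) :=
  LinearMap.range (S.i j).dualMap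

/-- Composition with `extClass`, as a linear map from the dual of a syzygy to `Ext`. -/
noncomputable def dualToExt (j : ℕ) :
    Module.Dual R (S.Z (j + 1)) →ₗ[R] ExtDual R (S.Z 0) (j + 1) :=
  (Ext.bilinearCompOfLinear R _ _ _ _ _ _ (add_zero (j + 1)) (S.extClass (j + 1))) ∘ₗ
    (extDualZeroEquiv (S.Z (j + 1))).symm.toLinearMap

lemma dualToExt_apply (j : ℕ) (k : Module.Dual R (S.Z (j + 1))) : S.dualToExt j k =
    (S.extClass (j + 1)).comp (Ext.mk₀ (ModuleCat.ofHom k)) (add_zero _) := rfl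

lemma surjective_dualToExt (j : ℕ) : Function.Surjective (S.dualToExt j) := fun x => by
  obtain ⟨f, hf⟩ := S.surjective_extClass_comp_mk₀ _ j x
  exact ⟨f.hom, hf⟩

lemma ker_dualToExt (j : ℕ) : LinearMap.ker (S.dualToExt j) = S.extendable j := by
  ext k
  rw [LinearMap.mem_ker, dualToExt_apply, extClass_comp_mk₀_eq_zero_iff]
  constructor
  · rintro ⟨g, hg⟩
    exact ⟨g.hom, congrArg ModuleCat.Hom.hom hg⟩
  · rintro ⟨g, rfl⟩
    exact ⟨ModuleCat.ofHom g, rfl⟩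

lemma extendable_eq_top {j : ℕ} (h : Subsingleton (ExtDual R (S.Z 0) (j + 1))) :
    S.extendable j = ⊤ := by
  rw [← ker_dualToExt, LinearMap.ker_eq_top]
  ext k
  exact Subsingleton.elim _ _

/-- `Ext^{j+1}(Z 0, R)` as a cokernel. -/
noncomputable def quotientEquivExt (j : ℕ) :
    (Module.Dual R (S.Z (j + 1)) ⧸ S.extendable j) ≃ₗ[R] ExtDual R (S.Z 0) (j + 1) :=
  (Submodule.quotEquivOfEq _ _ (S.ker_dualToExt j).symm).trans
    ((S.dualToExt j).quotKerEquivOfSurjective (S.surjective_dualToExt j))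

lemma quotientEquivExt_mk (j : ℕ) (k : Module.Dual R (S.Z (j + 1))) :
    S.quotientEquivExt j (Submodule.Quotient.mk k) = S.dualToExt j k := rfl

lemma hasTotallyReflexiveResolution {j k : ℕ}
    (h : IsTotallyReflexive R (S.Z (j + k))) : HasTotallyReflexiveResolution R (S.Z j) k := by
  induction k generalizing j with
  | zero => exact .of_isTotallyReflexive _ h
  | succ k ih =>
    exact (ih (j := j + 1) (by rwa [add_right_comm])).succ (S.i j) (S.p j) (S.injective j)
      (S.exact j) (S.surjective j) (isTotallyReflexive_of_finite_projective _)

end SyzygySequence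

end Syzygies

/-! ### The dualized resolution -/

section DualSyzygies

open Abelian

variable {R : Type u} [CommRing R]

namespace SyzygySequence

variable (S : SyzygySequence R)

/-- The dual of a syzygy, as an object of the category of modules. -/
abbrev dualZ (j : ℕ) : ModuleCat.{u} R := ModuleCat.of R (Module.Dual R (S.Z j))

/-- The dual of a projective module of the resolution. -/
abbrev dualP (j : ℕ) : ModuleCat.{u} R := ModuleCat.of R (Module.Dual R (S.P j))

/-- The functionals on `Z (j + 1)` that extend to `P j`, as an object of the category of
modules. -/
abbrev W (j : ℕ) : ModuleCat.{u} R := ModuleCat.of R (S.extendable j)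

/-- `Ext^{j+1}(Z 0, R)`, presented as a cokernel. -/
abbrev N (j : ℕ) : ModuleCat.{u} R := ModuleCat.of R (S.dualZ (j + 1) ⧸ S.extendable j)

/-- Restriction of functionals from `P j` to `Z (j + 1)`. -/
def restrict (j : ℕ) : S.dualP j →ₗ[R] S.W j := (S.i j).dualMap.rangeRestrict

/-- Inflation of functionals from `Z (j + 1)` to `P (j + 1)`. -/
def inflate (j : ℕ) : S.W j →ₗ[R] S.dualP (j + 1) :=
  (S.p (j + 1)).dualMap ∘ₗ (S.extendable j).subtype

lemma surjective_restrict (j : ℕ) : Function.Surjective (S.restrict j) :=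
  LinearMap.surjective_rangeRestrict _

/-- Functionals separate the points of the projective `P j`, which contains `Z (j + 1)`. -/
lemma eq_zero_of_forall_restrict {j : ℕ} {m : S.Z (j + 1)}
    (h : ∀ w : S.W j, w.1 m = 0) : m = 0 := by
  have h0 : S.i j m = 0 := (Module.forall_dual_apply_eq_zero_iff R _).1 fun f =>
    h (S.restrict j f)
  exact S.injective j (h0.trans (map_zero _).symm)

lemma shortExact_dual (j : ℕ) :
    IsShortExactSeq (A := S.dualZ j) (S.p j).dualMap (S.restrict j) where
  injective := LinearMap.dualMap_injective_of_surjective (S.surjective j)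
  surjective := S.surjective_restrict j
  exact f := by
    constructor
    · intro h
      have h' : f ∘ₗ S.i j = 0 := congrArg Subtype.val h
      have hf : f ∈ LinearMap.range (S.p j).dualMap := by
        rw [LinearMap.range_dualMap_eq_dualAnnihilator_ker_of_surjective _ (S.surjective j),
          Submodule.mem_dualAnnihilator]
        intro x hx
        obtain ⟨y, rfl⟩ := (S.exact j x).1 hx
        exact LinearMap.congr_fun h' y
      exact hf
    · rintro ⟨k, rfl⟩
      ext x
      exact (congrArg k (S.p_i j x)).trans (map_zero k)

/-- Under the hypothesis, `W j` is all of `Z (j + 1)*`; these sequences splice into the exact dual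
complex. -/
lemma shortExact_inflate {j : ℕ} (h : S.extendable j = ⊤) :
    IsShortExactSeq (S.inflate j) (S.restrict (j + 1)) where
  injective := (S.shortExact_dual (j + 1)).injective.comp Subtype.val_injective
  surjective := S.surjective_restrict (j + 1)
  exact f := by
    rw [(S.shortExact_dual (j + 1)).exact f]
    constructor
    · rintro ⟨k, rfl⟩
      exact ⟨⟨k, h ▸ Submodule.mem_top⟩, rfl⟩
    · rintro ⟨k, rfl⟩
      exact ⟨k.1, rfl⟩

lemma shortExact_quotient (j : ℕ) : IsShortExactSeq (A := S.W j) (B := S.dualZ (j + 1))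
    (C := S.N j) (S.extendable j).subtype (S.extendable j).mkQ where
  injective := Subtype.val_injective
  surjective := Submodule.mkQ_surjective _
  exact := LinearMap.exact_subtype_mkQ _

/-- If `Z 0` has zero dual, then all functionals on `P 0` are determined by their restriction. -/
noncomputable def restrictEquiv (h : Subsingleton (Module.Dual R (S.Z 0))) :
    S.dualP 0 ≃ₗ[R] S.W 0 :=
  LinearEquiv.ofBijective (S.restrict 0) ⟨by
    rw [injective_iff_map_eq_zero]
    intro f hf
    obtain ⟨k, rfl⟩ := ((S.shortExact_dual 0).exact f).1 hf
    rw [Subsingleton.elim k 0, map_zero], S.surjective_restrict 0⟩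

open Classical in
/-- The class in `Ext^j(W j, W 0)` of the first `j` steps of the dual sequence (it is only
meaningful if the first `j` cokernels vanish). -/
noncomputable def dualClass : ∀ j, Ext (S.W j) (S.W 0) j
  | 0 => Ext.mk₀ (𝟙 _)
  | j + 1 => if h : S.extendable j = ⊤ then
      (S.shortExact_inflate h).extClass.comp (dualClass j) (add_comm 1 j) else 0

lemma dualClass_succ_comp {j : ℕ} (h : S.extendable j = ⊤) {Y : ModuleCat.{u} R}
    (f : S.W 0 ⟶ Y) : (S.dualClass (j + 1)).comp (Ext.mk₀ f) (add_zero _) =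
      (S.shortExact_inflate h).extClass.comp
        ((S.dualClass j).comp (Ext.mk₀ f) (add_zero _)) (add_comm 1 j) := by
  rw [dualClass, dif_pos h, Ext.comp_assoc]
  omega

/-- Each connecting map `Ext^k(W k, Y) → Ext^{k+1}(W (k+1), Y)` is onto, because the middle term is
projective. -/
lemma exists_dualClass_comp_eq {Y : ModuleCat.{u} R} {j : ℕ}
    (h : ∀ k < j, S.extendable k = ⊤) (x : Ext (S.W j) Y j) :
    ∃ f : S.W 0 ⟶ Y, (S.dualClass j).comp (Ext.mk₀ f) (add_zero _) = x := by
  induction j with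
  | zero =>
    obtain ⟨f, rfl⟩ := (Ext.mk₀_bijective _ _).2 x
    exact ⟨f, Ext.mk₀_id_comp _⟩
  | succ j ih =>
    have : Subsingleton (Ext (S.dualP (j + 1)) Y (j + 1)) :=
      subsingleton_ext_of_projective j.succ_pos
    obtain ⟨y, rfl⟩ := (S.shortExact_inflate (h j j.lt_succ_self)).exists_extClass_comp_eq x
      (add_comm 1 j) (Subsingleton.elim _ _)
    obtain ⟨f, rfl⟩ := ih (fun k hk => h k (by omega)) y
    exact ⟨f, S.dualClass_succ_comp (h j j.lt_succ_self) f⟩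

/-- Evaluation at an element of `Z (j + 1)`. -/
def evalW (j : ℕ) (m : S.Z (j + 1)) : S.W j →ₗ[R] R :=
  (Module.Dual.eval R _ m) ∘ₗ (S.extendable j).subtype

/-- Evaluation at `m` extends over the middle term, as evaluation at a preimage of `m` in `P (j +
1)`. -/
lemma extClass_comp_evalW {j : ℕ} (h : S.extendable j = ⊤) (m : S.Z (j + 1)) :
    (S.shortExact_inflate h).extClass.comp
      (Ext.mk₀ (Y := ModuleCat.of R R) (ModuleCat.ofHom (S.evalW j m))) (add_zero 1) = 0 := by
  obtain ⟨e, rfl⟩ := S.surjective (j + 1) m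
  exact (S.shortExact_inflate h).extClass_comp_mk₀_eq_zero _
    (Module.Dual.eval R (S.P (j + 1)) e) fun _ => rfl

lemma dualClass_comp_evalW {j : ℕ} (h : ∀ k ≤ j, S.extendable k = ⊤) (m : S.Z 1) :
    (S.dualClass (j + 1)).comp
      (Ext.mk₀ (Y := ModuleCat.of R R) (ModuleCat.ofHom (S.evalW 0 m))) (add_zero _) = 0 := by
  induction j with
  | zero =>
    rw [S.dualClass_succ_comp (h 0 le_rfl), dualClass, Ext.mk₀_id_comp]
    exact S.extClass_comp_evalW (h 0 le_rfl) m
  | succ j ih =>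
    rw [S.dualClass_succ_comp (h _ le_rfl), ih fun k hk => h k (by omega), Ext.comp_zero]

/-- Pulled back to `P (j + 1)*`, the functional is evaluation at some `e`. It kills the inflations
from `W j`, which separate the points of `Z (j + 1)`, so `p e = 0`. This needs a step to the left,
hence the index `j + 1`; functionals on `W 0` are treated by `evalP`. -/
lemma exists_evalW_eq (j : ℕ) (f : S.W (j + 1) →ₗ[R] R) : ∃ m, f = S.evalW (j + 1) m := by
  obtain ⟨e, he⟩ := (Module.bijective_dual_eval R (S.P (j + 1))).2 (f ∘ₗ S.restrict (j + 1))
  have he' : ∀ g : S.dualP (j + 1), g e = f (S.restrict (j + 1) g) := fun g =>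
    LinearMap.congr_fun he g
  have h0 : S.p (j + 1) e = 0 := S.eq_zero_of_forall_restrict fun w => by
    have h1 : S.restrict (j + 1) (S.inflate j w) = 0 :=
      ((S.shortExact_dual (j + 1)).exact _).2 ⟨w.1, rfl⟩
    have h2 := he' (S.inflate j w)
    rw [h1, map_zero] at h2
    exact h2
  obtain ⟨m, rfl⟩ := (S.exact (j + 1) e).1 h0
  refine ⟨m, LinearMap.ext fun w => ?_⟩
  obtain ⟨g, rfl⟩ := S.surjective_restrict (j + 1) w
  exact (he' g).symm

/-- The dual complex resolves `W j` by projectives in length `j`, starting from `W 0 ≅ P 0*`. -/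
lemma subsingleton_ext_W_of_lt (h0 : Subsingleton (Module.Dual R (S.Z 0))) {Y : ModuleCat.{u} R}
    {j : ℕ} (h : ∀ k < j, S.extendable k = ⊤) {a : ℕ} (ha : j < a) :
    Subsingleton (Ext (S.W j) Y a) := by
  induction j generalizing a with
  | zero =>
    have : Module.Projective R (S.W 0) := Module.Projective.of_equiv (S.restrictEquiv h0)
    exact subsingleton_ext_of_projective ha
  | succ j ih =>
    exact (S.shortExact_inflate (h j j.lt_succ_self)).subsingleton_right
      (n := a - 1) (by omega) (ih (fun k hk => h k (by omega)) (by omega))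
      (subsingleton_ext_of_projective (by omega))

/-- Shifting reduces to degree one, where the obstruction classes are functionals on an earlier `W`;
those are evaluations, which extend. -/
lemma subsingleton_ext_W_of_gt {j : ℕ} (h : ∀ k < j, S.extendable k = ⊤) {a : ℕ} (h0 : 0 < a)
    (ha : a < j) : Subsingleton (Ext (S.W j) (ModuleCat.of R R) a) := by
  induction j generalizing a with
  | zero => omega
  | succ j ih =>
    have hj := h j j.lt_succ_self
    obtain rfl | h1 := Nat.eq_or_lt_of_le (Nat.succ_le_of_lt h0)
    · obtain ⟨j, rfl⟩ : ∃ k, j = k + 1 := ⟨j - 1, by omega⟩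
      refine subsingleton_of_forall_eq 0 fun x => ?_
      have : Subsingleton (Ext (S.dualP (j + 1 + 1)) (ModuleCat.of R R) 1) :=
        subsingleton_ext_of_projective one_pos
      obtain ⟨y, rfl⟩ := (S.shortExact_inflate hj).exists_extClass_comp_eq x (add_zero 1)
        (Subsingleton.elim _ _)
      obtain ⟨f, rfl⟩ := (Ext.mk₀_bijective _ _).2 y
      obtain ⟨m, hm⟩ := S.exists_evalW_eq j f.hom
      obtain rfl : f = ModuleCat.ofHom (S.evalW (j + 1) m) := ModuleCat.hom_ext hm
      exact S.extClass_comp_evalW hj m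
    · exact (S.shortExact_inflate hj).subsingleton_right
        (n := a - 1) (by omega) (ih (fun k hk => h k (by omega)) (by omega) (by omega))
        (subsingleton_ext_of_projective h0)

end SyzygySequence

end DualSyzygies

/-! ### The transpose of a self-duality -/

section SelfDual

open Abelian

variable {R : Type u} [CommRing R]

namespace SyzygySequence

variable (S : SyzygySequence R)

/-- A class in `Ext^{n+1}(X, W 0)` that vanishes in `Ext^{n+1}(X, P 1^*)` comes from
`Ext^1(X, W n)`, when the groups `Ext^a(X, R)` in between vanish. -/
lemma exists_comp_dualClass_eq {X : ModuleCat.{u} R} {n : ℕ}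
    (hX : ∀ a, a ≤ n → Subsingleton (Ext X (ModuleCat.of R R) a)) {j : ℕ} (hj : j ≤ n)
    (h : ∀ k < j, S.extendable k = ⊤) (c : Ext X (S.W 0) (n + 1))
    (hc : 0 < j → c.comp (Ext.mk₀ (ModuleCat.ofHom (S.inflate 0))) (add_zero _) = 0)
    {a : ℕ} (ha : a + j = n + 1) :
    ∃ x : Ext X (S.W j) a, x.comp (S.dualClass j) ha = c := by
  induction j generalizing a with
  | zero =>
    obtain rfl : a = n + 1 := ha
    exact ⟨c, Ext.comp_mk₀_id c⟩
  | succ j ih =>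
    have hj' := h j j.lt_succ_self
    obtain ⟨x, hx⟩ := ih (by omega) (fun k hk => h k (by omega)) (fun _ => hc j.succ_pos)
      (a := a + 1) (by omega)
    have hx0 : x.comp (Ext.mk₀ (ModuleCat.ofHom (S.inflate j))) (add_zero _) = 0 := by
      -- The first step lives in degree `n + 1`, where `Ext(X, R)` may be nonzero, hence the
      -- hypothesis `hc`; later steps have degree at most `n`.
      rcases j with _ | j
      · obtain rfl : a = n := by omega
        have : x = c := (Ext.comp_mk₀_id x).symm.trans hx
        rw [this]
        exact hc one_pos
      · have := subsingleton_ext_of_finite_projective (F := S.dualP (j + 1 + 1))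
          (hX (a + 1) (by omega))
        exact Subsingleton.elim _ _
    obtain ⟨y, hy⟩ := (S.shortExact_inflate hj').exists_comp_extClass_eq x rfl hx0
    refine ⟨y, ?_⟩
    rw [dualClass, dif_pos hj', ← hx, ← hy]
    exact (Ext.comp_assoc _ _ _ _ _ (by omega)).symm

lemma subsingleton_linearMap_dual {X Y : Type u} [AddCommGroup X] [AddCommGroup Y] [Module R X]
    [Module R Y] (h : Subsingleton (Module.Dual R X)) :
    Subsingleton (X →ₗ[R] Module.Dual R Y) :=
  ⟨fun f g => LinearMap.ext fun x => LinearMap.ext fun y =>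
    LinearMap.congr_fun (Subsingleton.elim (f.flip y) (g.flip y)) x⟩

/-- In `0 → Z j* → P j* → W j → 0`, the term `Hom(X, W j)` embeds in `Hom(X, Z (j+1)*)`, which is
zero by swapping arguments. -/
lemma subsingleton_ext_one_dualZ {X : ModuleCat.{u} R} (h0 : Subsingleton (Module.Dual R X))
    (h1 : Subsingleton (Ext X (ModuleCat.of R R) 1)) (j : ℕ) :
    Subsingleton (Ext X (S.dualZ j) 1) := by
  refine subsingleton_of_forall_eq 0 fun x => ?_
  have := subsingleton_ext_of_finite_projective (F := S.dualP j) h1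
  obtain ⟨y, rfl⟩ := (S.shortExact_dual j).exists_comp_extClass_eq x (zero_add 1)
    (Subsingleton.elim _ _)
  obtain ⟨f, rfl⟩ := (Ext.mk₀_bijective _ _).2 y
  have := subsingleton_linearMap_dual (Y := S.Z (j + 1)) h0
  have hf : f = 0 := ModuleCat.hom_ext (LinearMap.ext fun x => Subtype.ext
    (LinearMap.congr_fun (Subsingleton.elim ((S.extendable j).subtype ∘ₗ f.hom) 0) x))
  rw [hf, Ext.mk₀_zero, Ext.zero_comp]

/-- The class in `Ext^{n+1}(N n, W 0)` of the dual sequence. -/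
noncomputable def totalClass (n : ℕ) : Ext (S.N n) (S.W 0) (n + 1) :=
  (S.shortExact_quotient n).extClass.comp (S.dualClass n) (add_comm 1 n)

section Pairing

variable {S} {n : ℕ} (h0 : Subsingleton (Module.Dual R (S.Z 0)))
  (hS : ∀ a, a ≤ n → Subsingleton (ExtDual R (S.Z 0) a))

/-- The transpose `Z (n + 1) → W 0` of a map `P 0 → (Z (n + 1))^*`. -/
noncomputable def transpose (b : S.P 0 →ₗ[R] S.dualZ (n + 1)) : S.Z (n + 1) →ₗ[R] S.W 0 :=
  (S.restrictEquiv h0).toLinearMap ∘ₗ b.flip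

include hS in
lemma extendable_eq_top_of_lt {k : ℕ} (hk : k < n) : S.extendable k = ⊤ :=
  S.extendable_eq_top (hS (k + 1) hk)

include hS in
/-- A lift `b : P 0 → (Z (n + 1))^*` of a map `φ : Z 0 → N n` induces, by transposition, a map
`Z 0 → N n`. -/
lemma exists_transpose (φ : S.Z 0 →ₗ[R] S.N n) (b : S.P 0 →ₗ[R] S.dualZ (n + 1))
    (hb : ∀ e, (S.extendable n).mkQ (b e) = φ (S.p 0 e)) :
    ∃ ψ : S.Z 0 ⟶ S.N n, (Ext.mk₀ ψ).comp (S.totalClass n) (zero_add _) =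
      (S.extClass (n + 1)).comp (Ext.mk₀ (Y := S.W 0) (ModuleCat.ofHom (transpose h0 b)))
        (add_zero _) := by
  have hb0 : ∀ m : S.Z 1, b (S.i 0 m) ∈ S.extendable n := fun m => by
    rw [← Submodule.ker_mkQ (S.extendable n), LinearMap.mem_ker, hb, p_i, map_zero]
  let b' : S.Z 1 →ₗ[R] S.W n := (b ∘ₗ S.i 0).codRestrict _ hb0
  set c := (S.extClass (n + 1)).comp (Ext.mk₀ (Y := S.W 0) (ModuleCat.ofHom (transpose h0 b)))
    (add_zero _)
    with hc
  have hc0 : 0 < n → c.comp (Ext.mk₀ (ModuleCat.ofHom (S.inflate 0))) (add_zero _) = 0 := by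
    intro _
    -- The lift `γ : P 1 → P n*` transposes to `P n → P 1*`, which extends the composite `Z (n+1) →
    -- W 0 → P 1*`; its class therefore vanishes.
    obtain ⟨γ, hγ⟩ := Module.projective_lifting_property (S.restrict n) (b' ∘ₗ S.p 1)
      (S.surjective_restrict n)
    rw [hc, Ext.comp_assoc_of_third_deg_zero, Ext.mk₀_comp_mk₀]
    refine (S.extClass_comp_mk₀_eq_zero_iff n _).2 ⟨ModuleCat.ofHom γ.flip, ?_⟩
    refine ModuleCat.hom_ext (LinearMap.ext fun k => LinearMap.ext fun y => ?_)
    have h1 : (S.restrict n (γ y)).1 k = (b' (S.p 1 y)).1 k :=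
      congrArg (fun w : S.W n => w.1 k) (LinearMap.congr_fun hγ y)
    exact h1
  obtain ⟨x, hx⟩ := S.exists_comp_dualClass_eq hS le_rfl
    (fun k hk => extendable_eq_top_of_lt hS hk) c hc0 (add_comm 1 n)
  have hx0 : x.comp (Ext.mk₀ (ModuleCat.ofHom (Y := S.dualZ (n + 1)) (S.extendable n).subtype))
      (add_zero _) = 0 := by
    -- For `n = 0` the same transposition trick gives an explicit extension to `P 0`; otherwise the
    -- obstruction group `Ext^1(Z 0, Z (n+1)*)` is zero.
    rcases n with _ | n
    · have : x = c := (Ext.comp_mk₀_id x).symm.trans hx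
      rw [this, hc, Ext.comp_assoc_of_third_deg_zero, Ext.mk₀_comp_mk₀]
      refine (S.extClass_comp_mk₀_eq_zero_iff 0 _).2
        ⟨ModuleCat.ofHom ((S.restrictEquiv h0).symm.toLinearMap ∘ₗ b').flip, ?_⟩
      refine ModuleCat.hom_ext (LinearMap.ext fun k => LinearMap.ext fun m => ?_)
      have h1 : (S.restrictEquiv h0 ((S.restrictEquiv h0).symm (b' m))).1 k = (b' m).1 k := by
        rw [LinearEquiv.apply_symm_apply]
      exact h1
    · have := S.subsingleton_ext_one_dualZ h0 (hS 1 (by omega)) (n + 1 + 1)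
      exact Subsingleton.elim _ _
  obtain ⟨y, hy⟩ := (S.shortExact_quotient n).exists_comp_extClass_eq x (zero_add 1) hx0
  obtain ⟨ψ, rfl⟩ := (Ext.mk₀_bijective _ _).2 y
  refine ⟨ψ, ?_⟩
  rw [totalClass, ← hx, ← hy]
  exact (Ext.comp_assoc _ _ _ _ _ (by omega)).symm

/-- Evaluation at an element of `P 0`, as a functional on `W 0`. -/
noncomputable def evalP (e : S.P 0) : S.W 0 →ₗ[R] R :=
  (Module.Dual.eval R (S.P 0) e) ∘ₗ (S.restrictEquiv h0).symm.toLinearMap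

lemma evalP_restrictEquiv (e : S.P 0) (f : S.dualP 0) :
    evalP h0 e (S.restrictEquiv h0 f) = f e :=
  congrArg (fun g : S.dualP 0 => g e) ((S.restrictEquiv h0).symm_apply_apply f)

lemma evalP_i (m : S.Z 1) : evalP h0 (S.i 0 m) = S.evalW 0 m := by
  ext w
  obtain ⟨f, rfl⟩ := (S.restrictEquiv h0).surjective w
  exact evalP_restrictEquiv h0 _ f

lemma exists_evalP_eq (f : S.W 0 →ₗ[R] R) : ∃ e, f = evalP h0 e := by
  obtain ⟨e, he⟩ := (Module.bijective_dual_eval R (S.P 0)).2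
    (f ∘ₗ (S.restrictEquiv h0).toLinearMap)
  refine ⟨e, LinearMap.ext fun w => ?_⟩
  obtain ⟨g, rfl⟩ := (S.restrictEquiv h0).surjective w
  rw [evalP_restrictEquiv]
  exact (LinearMap.congr_fun he g).symm

include hS in
-- The biduality statement for `Ext^{n+1}`: `Ψ`, induced by the transpose `ψ`, recovers `φ (p 0 e)`
-- from the class of `e`. Hence `Ψ` is onto, then injective, and both claims are read off from `φ`.
lemma exists_totalClass_comp_evalP [IsNoetherianRing R] (φ : S.Z 0 ≃ₗ[R] S.N n) :
    (∀ e, (S.totalClass n).comp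
      (Ext.mk₀ (Y := ModuleCat.of R R) (ModuleCat.ofHom (evalP h0 e))) (add_zero _) = 0 →
        S.p 0 e = 0) ∧
    ∀ x : ExtDual R (S.N n) (n + 1), ∃ e, (S.totalClass n).comp
      (Ext.mk₀ (Y := ModuleCat.of R R) (ModuleCat.ofHom (evalP h0 e))) (add_zero _) = x := by
  obtain ⟨b, hb⟩ := Module.projective_lifting_property (S.extendable n).mkQ
    (φ.toLinearMap ∘ₗ S.p 0) (Submodule.mkQ_surjective _)
  have hb' : ∀ e, (S.extendable n).mkQ (b e) = φ (S.p 0 e) := fun e => LinearMap.congr_fun hb e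
  obtain ⟨ψ, hψ⟩ := exists_transpose h0 hS φ.toLinearMap b hb'
  let Ψ : ExtDual R (S.N n) (n + 1) →ₗ[R] ExtDual R (S.Z 0) (n + 1) :=
    Ext.bilinearCompOfLinear R _ _ _ _ _ _ (zero_add (n + 1)) (Ext.mk₀ ψ)
  have key : ∀ e, Ψ ((S.totalClass n).comp
      (Ext.mk₀ (Y := ModuleCat.of R R) (ModuleCat.ofHom (evalP h0 e))) (add_zero _)) =
        S.quotientEquivExt n (φ (S.p 0 e)) := fun e => by
    have h1 : ModuleCat.ofHom (X := S.Z (n + 1)) (Y := S.W 0) (transpose h0 b) ≫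
        ModuleCat.ofHom (X := S.W 0) (Y := R) (evalP h0 e) =
          ModuleCat.ofHom (X := S.Z (n + 1)) (Y := R) (b e) :=
      ModuleCat.hom_ext (LinearMap.ext fun k => evalP_restrictEquiv h0 e _)
    refine (mk₀_comp_comp_mk₀_eq hψ _).trans ?_
    rw [← hb', h1]
    exact (S.quotientEquivExt_mk n (b e)).symm
  have hsurj : ∀ x, ∃ e, S.quotientEquivExt n (φ (S.p 0 e)) = x := fun x => by
    obtain ⟨y, rfl⟩ := (S.quotientEquivExt n).surjective x
    obtain ⟨z, rfl⟩ := φ.surjective y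
    obtain ⟨e, rfl⟩ := S.surjective 0 z
    exact ⟨e, rfl⟩
  have hΨ : Function.Injective Ψ := by
    refine injective_of_surjective_of_equiv
      ((extDualCongr φ (n + 1)).trans ((S.quotientEquivExt n).symm.trans φ.symm))
      ((S.quotientEquivExt n).symm.trans φ.symm) Ψ fun x => ?_
    obtain ⟨e, rfl⟩ := hsurj x
    exact ⟨_, key e⟩
  refine ⟨fun e he => ?_, fun x => ?_⟩
  · have := key e
    rw [he, map_zero] at this
    exact φ.injective ((S.quotientEquivExt n).injective
      (by rw [← this, map_zero, map_zero]))
  · obtain ⟨e, he⟩ := hsurj (Ψ x)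
    exact ⟨e, hΨ ((key e).trans he)⟩

end Pairing

end SyzygySequence

end SelfDual

/-! ### Total reflexivity of the syzygy and conclusion -/

section MainTheorem

open Abelian

variable {R : Type u} [CommRing R]

namespace SyzygySequence

variable {S : SyzygySequence R} {n : ℕ} [IsNoetherianRing R]

/-- A functional on `Z (n+1)*` is determined by its restriction to `W n`, since `N n ≅ Z 0` has zero
dual; that restriction is an evaluation. -/
lemma bijective_eval_Z (φ : S.Z 0 ≃ₗ[R] S.N n)
    (hS : ∀ a, a ≤ n → Subsingleton (ExtDual R (S.Z 0) a)) :
    Function.Bijective (Module.Dual.eval R (S.Z (n + 1))) := by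
  have h0 : Subsingleton (Module.Dual R (S.Z 0)) :=
    have := hS 0 (Nat.zero_le n)
    (extDualZeroEquiv (S.Z 0)).symm.toEquiv.subsingleton
  constructor
  · rw [injective_iff_map_eq_zero]
    exact fun m hm => S.eq_zero_of_forall_restrict fun w => LinearMap.congr_fun hm w.1
  · intro α
    have hα : ∃ m, α ∘ₗ (S.extendable n).subtype = S.evalW n m := by
      -- For `n = 0` the restriction is only known to be evaluation at some `e` in `P 0`. It extends
      -- to `Z 1*`, so `totalClass` kills it, which forces `e` into `Z 1`.
      rcases n with _ | n
      · obtain ⟨e, he⟩ := exists_evalP_eq h0 (α ∘ₗ (S.extendable 0).subtype)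
        have h1 : S.p 0 e = 0 := by
          refine (exists_totalClass_comp_evalP h0 hS φ).1 e ?_
          rw [← he, totalClass, dualClass, Ext.comp_mk₀_id]
          exact (S.shortExact_quotient 0).extClass_comp_mk₀_eq_zero _ α fun _ => rfl
        obtain ⟨m, rfl⟩ := (S.exact 0 e).1 h1
        exact ⟨m, he.trans (evalP_i h0 m)⟩
      · exact S.exists_evalW_eq n _
    obtain ⟨m, hm⟩ := hα
    refine ⟨m, (sub_eq_zero.1 (LinearMap.ext fun k => ?_)).symm⟩
    have h2 : S.extendable n ≤ LinearMap.ker (α - Module.Dual.eval R _ m) := fun w hw =>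
      sub_eq_zero.2 (LinearMap.congr_fun hm ⟨w, hw⟩)
    have h3 : Subsingleton (Module.Dual R (S.N n)) := φ.symm.dualMap.symm.toEquiv.subsingleton
    exact LinearMap.congr_fun
      (Subsingleton.elim (α := Module.Dual R (S.N n)) ((S.extendable n).liftQ _ h2) 0)
      (Submodule.Quotient.mk k)

/-- Long exact sequence of `0 → W n → Z (n+1)* → N n → 0`: both outer groups vanish except in degree
`n` for `W n` and degree `n + 1` for `N n`. There the connecting map between them must be injective
and surjective, respectively. -/
lemma subsingleton_ext_dualZ (φ : S.Z 0 ≃ₗ[R] S.N n)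
    (hS : ∀ a, a ≠ n + 1 → Subsingleton (ExtDual R (S.Z 0) a)) {a : ℕ} (ha : 0 < a) :
    Subsingleton (ExtDual R (S.dualZ (n + 1)) a) := by
  have hS' : ∀ a, a ≤ n → Subsingleton (ExtDual R (S.Z 0) a) := fun a ha => hS a (by omega)
  have h0 : Subsingleton (Module.Dual R (S.Z 0)) :=
    have := hS' 0 (Nat.zero_le n)
    (extDualZeroEquiv (S.Z 0)).symm.toEquiv.subsingleton
  have hN : ∀ a, a ≠ n + 1 → Subsingleton (Ext (S.N n) (ModuleCat.of R R) a) := fun a ha =>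
    have := hS a ha
    (extDualCongr φ a).toEquiv.subsingleton
  have htop : ∀ k < n, S.extendable k = ⊤ := fun k hk => extendable_eq_top_of_lt hS' hk
  have hq := S.shortExact_quotient n
  obtain ⟨hinj, hsurj⟩ := exists_totalClass_comp_evalP h0 hS' φ
  have hassoc : ∀ f : S.W 0 ⟶ ModuleCat.of R R,
      (S.totalClass n).comp (Ext.mk₀ f) (add_zero _) =
        hq.extClass.comp ((S.dualClass n).comp (Ext.mk₀ f) (add_zero _)) (add_comm 1 n) :=
    fun f => Ext.comp_assoc _ _ _ _ _ (by omega)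
  obtain hlt | rfl | hgt := lt_trichotomy a n
  · exact hq.subsingleton_middle (S.subsingleton_ext_W_of_gt htop ha hlt) (hN a (by omega))
  -- The restriction of `x` to `W a` comes from evaluation at some `e`, and the connecting map kills
  -- it. So `e` lies in `Z 1`, and evaluations there die in `dualClass` because `a > 0`.
  · refine subsingleton_of_forall_eq 0 fun x => ?_
    let ι : S.W a ⟶ S.dualZ (a + 1) := ModuleCat.ofHom (S.extendable a).subtype
    have hx : (Ext.mk₀ ι).comp x (zero_add a) = 0 := by
      obtain ⟨f, hf⟩ := S.exists_dualClass_comp_eq htop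
        ((Ext.mk₀ ι).comp x (zero_add a))
      obtain ⟨e, he⟩ := exists_evalP_eq h0 f.hom
      obtain rfl : f = ModuleCat.ofHom (evalP h0 e) := ModuleCat.hom_ext he
      have h1 : S.p 0 e = 0 := by
        refine hinj e ((hassoc _).trans ?_)
        rw [hf]
        exact hq.extClass_comp_mk₀_comp x _
      obtain ⟨m, rfl⟩ := (S.exact 0 e).1 h1
      obtain ⟨j, rfl⟩ : ∃ j, a = j + 1 := ⟨a - 1, by omega⟩
      rw [← hf, evalP_i]
      exact S.dualClass_comp_evalW (fun k hk => htop k (by omega)) m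
    obtain ⟨y, rfl⟩ := hq.exists_mk₀_g_comp_eq x hx
    have := hN a (by omega)
    rw [Subsingleton.elim y 0, Ext.comp_zero]
  · have hW : Subsingleton (Ext (S.W n) (ModuleCat.of R R) a) :=
      S.subsingleton_ext_W_of_lt h0 htop hgt
    -- In this degree every class on `N n` is a value of the connecting map, hence becomes zero on
    -- `Z (n+1)*`.
    by_cases hn : a = n + 1
    · subst hn
      refine subsingleton_of_forall_eq 0 fun x => ?_
      obtain ⟨y, rfl⟩ := hq.exists_mk₀_g_comp_eq x (Subsingleton.elim _ _)
      obtain ⟨e, rfl⟩ := hsurj y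
      rw [hassoc]
      exact hq.mk₀_comp_extClass_comp _ _
    · exact hq.subsingleton_middle hW (hN a hn)

lemma isTotallyReflexive_Z (e : ExtDual R (S.Z 0) (n + 1) ≃ₗ[R] S.Z 0)
    (hS : ∀ a, a ≠ n + 1 → Subsingleton (ExtDual R (S.Z 0) a)) :
    IsTotallyReflexive R (S.Z (n + 1)) :=
  let φ : S.Z 0 ≃ₗ[R] S.N n := ((S.quotientEquivExt n).trans e).symm
  { finite := inferInstance
    bijective_eval := bijective_eval_Z φ fun a ha => hS a (by omega)
    ext_eq_zero := fun i hi => by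
      obtain ⟨i, rfl⟩ : ∃ j, i = j + 1 := ⟨i - 1, by omega⟩
      exact S.subsingleton_extDual_Z (hS _ (by omega))
    ext_dual_eq_zero := fun i hi => subsingleton_ext_dualZ φ hS hi }

end SyzygySequence

lemma hasTotallyReflexiveResolution_of_extDual_equiv [IsNoetherianRing R] (M : ModuleCat.{u} R)
    [Module.Finite R M] {g : ℕ} (e : ExtDual R M g ≃ₗ[R] M)
    (h : ∀ i, i ≠ g → Subsingleton (ExtDual R M i)) : HasTotallyReflexiveResolution R M g := by
  rcases g with _ | n
  · exact .of_isTotallyReflexive _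
      (isTotallyReflexive_of_equiv_dual M e fun i hi => h i hi.ne')
  · obtain ⟨S, rfl⟩ := SyzygySequence.exists_Z_zero_eq M
    refine S.hasTotallyReflexiveResolution ?_
    rw [zero_add]
    exact SyzygySequence.isTotallyReflexive_Z e h

lemma IsTotallySelfDual.isGPerfect_and_nonempty_equiv [IsNoetherianRing R] {M : Type u}
    [AddCommGroup M] [Module R M] [Module.Finite R M] {g : ℕ} (hg : moduleGrade R M = g)
    (h : IsTotallySelfDual R M) : IsGPerfect R M ∧ Nonempty (ExtDual R M g ≃ₗ[R] M) := by
  obtain ⟨hM, g', hg', ⟨e⟩, hvan⟩ := h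
  obtain rfl : g' = g := by exact_mod_cast hg'.symm.trans hg
  have hres : HasTotallyReflexiveResolution R M g' :=
    hasTotallyReflexiveResolution_of_extDual_equiv (ModuleCat.of R M) e hvan
  exact ⟨⟨hM, hg.trans (gorensteinDim_eq_of_hasTotallyReflexiveResolution hres
    (nontrivial_extDual_of_moduleGrade_eq hg)).symm⟩, ⟨e⟩⟩

end MainTheorem

theorem mainTheorem6 (R : Type u) [CommRing R] [IsNoetherianRing R] (g : ℕ) :
    (∀ (M : Type u) [AddCommGroup M] [Module R M] [Module.Finite R M] [Nontrivial M],
      moduleGrade R M = g →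
        (IsTotallySelfDual R M ↔
          IsGPerfect R M ∧ Nonempty (ExtDual R M g ≃ₗ[R] M))) ∧
    {M : ModuleCat.{u} R | Module.Finite R M ∧ IsTotallySelfDual R M ∧ moduleGrade R M = g} =
      {M : ModuleCat.{u} R | M ∈ gPerfectModules R g ∧ Nonempty (ExtDual R M g ≃ₗ[R] M)} := by
  refine ⟨fun M _ _ _ _ hg => ⟨fun h => h.isGPerfect_and_nonempty_equiv hg,
    fun h => .of_isGPerfect hg h.1 h.2⟩, ?_⟩
  ext M
  constructor
  · rintro ⟨hfin, h, hg⟩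
    obtain ⟨hp, he⟩ := h.isGPerfect_and_nonempty_equiv hg
    exact ⟨⟨hfin, hp, hg⟩, he⟩
  · rintro ⟨⟨hfin, hp, hg⟩, he⟩
    exact ⟨hfin, .of_isGPerfect hg hp he, hg⟩
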